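/- Let $n\ge 0$ and consider $\mathfrak{gl}(n,n)$, with characters regarded as elements of the field of rational functions in $x_1,\dots,x_n,y_1,\dots,y_n$ (the fraction field of the ring of Laurent polynomials $\mathbb Z[x_i^{\pm1},y_j^{\pm1}]$). Put $\Delta(x)=\prod_{i>j}(1-x_i/x_j)$, $\Delta(y)=\prod_{i>j}(1-y_i/y_j)$, $x^{\rho}=\prod_i x_i^{n-i}$, $y^{\rho}=\prod_j y_j^{n-j}$, and $\{f\}=\sum_{w\in S_n\times S_n}\varepsilon(w)\,w(f)$. For a finite set $B=\{b_1>\dots>b_p\}\subset\mathbb Z$ with $p\le n$, let $\tau_i=b_i+i-1$ and $\nu_j=-\tau_{p+1-j}$ $(1\le i,j\le p)$. The Euler character $\mathrm{ch}\,E(B)$ is given by $$ \mathrm{ch}\,E(B)\,\Delta(x)x^{\rho}\Delta(y)y^{\rho}=\Big\{\prod_{i=1}^{p}\prod_{j=1}^{n}\Big(1+\frac{y_j}{x_i}\Big)\prod_{i=p+1}^{n}\prod_{j=1}^{p}\Big(1+\frac{x_i}{y_j}\Big)\prod_{i=1}^p x_i^{\tau_i}y_i^{\nu_i}\;x^{\rho}y^{\rho}\Big\},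 $$ and $\mathrm{ch}\,E(B)=0$ if $|B|>n$. For $|A|=n$, with $\tau,\nu$ defined from $A$ in the same way, the character of the Kac module is $\mathrm{ch}\,K(A)=\prod_{i,j}(1+y_j/x_i)\,s_{\tau}(x)s_{\nu}(y)$, where $s_\lambda$ is the Schur function (quotient of alternants) of a non-increasing integer sequence. Let $\omega(B)=\{b-1: b\in B\}$, and let $T$ be the operator of multiplication by $\dfrac{y_1\cdots y_n}{x_1\cdots x_n}$, i.e. the operator induced on characters by tensoring with the one-dimensional module of this character. Then: (1) $T(\mathrm{ch}\,K(A))=\mathrm{ch}\,K(\omega(A))$ for every $A\subset\mathbb Z$ with $|A|=n$. (2) For every finite $B\subset\mathbb Z_{\le 0}$, with $p=|B|$, $$ T(\mathrm{ch}\,E(B))=(-1)^{n+p}\left[\mathrm{ch}\,E(\omega(B))-(-1)^p\,\mathrm{ch}\,E(\{0\}\cup\omega(B))\right]. $$ -/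

import Mathlib

open Finset

namespace GLSuper

/-! ### Expressions in variables `x_1, …, x_m`, `y_1, …, y_n`

They are written as functions of a point with coordinates in a field `F`; below `F` is the field of
rational functions and the point consists of the variables themselves. -/

section Expressions

variable {F : Type*} [Field F]

/-- `Δ(x) = ∏_{i > j} (1 - x_i / x_j)`. -/
def delta {k : ℕ} (x : Fin k → F) : F :=
  ∏ i : Fin k, ∏ j ∈ Finset.Iio i, (1 - x i / x j)

/-- `x^{ρ_k}` with `ρ_k = (k - 1, k - 2, …, 0)`. -/
def rhoMonomial {k : ℕ} (x : Fin k → F) : F :=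
  ∏ i : Fin k, x i ^ (k - 1 - (i : ℕ))

/-- `Δ(x, y) = ∏_{i, j} (1 + y_j / x_i)`. -/
def deltaMixed {m n : ℕ} (x : Fin m → F) (y : Fin n → F) : F :=
  ∏ i : Fin m, ∏ j : Fin n, (1 + y j / x i)

/-- The alternation `∑_{w ∈ S_k} ε(w) w(f(x))`. -/
def alternate {k : ℕ} (f : (Fin k → F) → F) (x : Fin k → F) : F :=
  ∑ σ : Equiv.Perm (Fin k), ((Equiv.Perm.sign σ : ℤ) : F) * f (x ∘ σ)

/-- The alternation `{f(x, y)} = ∑_{w ∈ S_m × S_n} ε(w) w(f(x, y))`. -/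
def alternatePair {m n : ℕ} (f : (Fin m → F) → (Fin n → F) → F)
    (x : Fin m → F) (y : Fin n → F) : F :=
  ∑ σ : Equiv.Perm (Fin m), ∑ τ : Equiv.Perm (Fin n),
    ((Equiv.Perm.sign σ : ℤ) : F) * ((Equiv.Perm.sign τ : ℤ) : F) * f (x ∘ σ) (y ∘ τ)

/-- The Schur function `s_λ(x)` of a non-increasing sequence `λ` of (possibly negative) integers:
`s_λ(x) Δ(x) x^{ρ_k} = ∑_{w ∈ S_k} ε(w) w(x^λ x^{ρ_k})`. -/
def schur {k : ℕ} (lam : Fin k → ℤ) (x : Fin k → F) : F :=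
  alternate (fun u => (∏ i, u i ^ lam i) * rhoMonomial u) x / (delta x * rhoMonomial x)

/-- The expression inside the alternation in the formula for the Euler character, namely
`∏_{(i,j) ∈ D₊} (1 + y_j / x_i) ∏_{(i,j) ∈ D₋} (1 + x_i / y_j) x^τ y^ν x^{ρ_m} y^{ρ_n}`
with `D₊ = [1, r] × [1, n]` and `D₋ = [r + 1, m] × [1, s]`. -/
def eulerTerm {m n r s : ℕ} (hr : r ≤ m) (hs : s ≤ n) (τ : Fin r → ℤ) (ν : Fin s → ℤ)
    (x : Fin m → F) (y : Fin n → F) : F :=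
  (∏ i : Fin r, ∏ j : Fin n, (1 + y j / x (Fin.castLE hr i))) *
  (∏ i ∈ Finset.univ.filter (fun i : Fin m => r ≤ (i : ℕ)), ∏ j : Fin s, (1 + x i / y (Fin.castLE hs j))) *
  (∏ i : Fin r, x (Fin.castLE hr i) ^ τ i) * (∏ j : Fin s, y (Fin.castLE hs j) ^ ν j) *
  rhoMonomial x * rhoMonomial y

/-- The Euler character `ch E(χ_{r,s})` of `χ_{r,s} = ∑ τ_i ε_i + ∑ ν_j δ_j`. -/
def eulerOfWeight {m n r s : ℕ} (hr : r ≤ m) (hs : s ≤ n) (τ : Fin r → ℤ) (ν : Fin s → ℤ)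
    (x : Fin m → F) (y : Fin n → F) : F :=
  alternatePair (eulerTerm hr hs τ ν) x y /
    (delta x * rhoMonomial x * (delta y * rhoMonomial y))

/-- The character of the Kac module with highest weight `∑ λ_i ε_i + ∑ μ_j δ_j`. -/
def kacOfWeight {m n : ℕ} (lam : Fin m → ℤ) (mu : Fin n → ℤ)
    (x : Fin m → F) (y : Fin n → F) : F :=
  deltaMixed x y * schur lam x * schur mu y

/-! ### From diagrams `(A, B)` to weights -/

/-- The sequence `τ_1 ≥ … ≥ τ_r`, `r = |A|`, such that `A = {τ_1, τ_2 - 1, …, τ_r + 1 - r}`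
(the elements of `A` being listed there in decreasing order). -/
def xWeight (A : Finset ℤ) : Fin A.card → ℤ :=
  fun i => A.orderEmbOfFin rfl (Fin.rev i) + (i : ℤ)

/-- The sequence `ν_1 ≥ … ≥ ν_s`, `s = |B|`, such that
`B = {s - r - ν_s, s - r - ν_{s-1} - 1, …, 1 - r - ν_1}`
(the elements of `B` being listed there in decreasing order). -/
def yWeight (r : ℕ) (B : Finset ℤ) : Fin B.card → ℤ :=
  fun j => (j : ℤ) + 1 - (r : ℤ) - B.orderEmbOfFin rfl j

/-- The Euler character of the diagram `(A, B)` for `𝔤𝔩(m, n)`, where `|A| - |B| = m - n`; it is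
zero if `A` has more than `m` or `B` more than `n` elements. -/
def eulerOfDiagram {m n : ℕ} (A B : Finset ℤ) (x : Fin m → F) (y : Fin n → F) : F :=
  if h : A.card ≤ m ∧ B.card ≤ n then
    eulerOfWeight h.1 h.2 (xWeight A) (yWeight A.card B) x y
  else 0

/-- The character of the Kac module of the diagram `(A, B)` for `𝔤𝔩(m, n)`,
where `|A| = m` and `|B| = n`. -/
def kacOfDiagram {m n : ℕ} (A B : Finset ℤ) (hA : A.card = m) (hB : B.card = n)
    (x : Fin m → F) (y : Fin n → F) : F :=
  kacOfWeight (fun i => xWeight A (Fin.cast hA.symm i))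
    (fun j => yWeight A.card B (Fin.cast hB.symm j)) x y

end Expressions

/-! ### Characters for `𝔤𝔩(n, n)` -/

/-- The field of rational functions in `x_1, …, x_n, y_1, …, y_n`, the field of fractions of the
ring of Laurent polynomials `ℤ[x_1^{±1}, …, x_n^{±1}, y_1^{±1}, …, y_n^{±1}]`. -/
abbrev CharField (n : ℕ) : Type := FractionRing (MvPolynomial (Fin n ⊕ Fin n) ℤ)

/-- The variable `x_i = e^{ε_i}`. -/
noncomputable def varX (n : ℕ) (i : Fin n) : CharField n :=
  algebraMap (MvPolynomial (Fin n ⊕ Fin n) ℤ) (CharField n) (MvPolynomial.X (Sum.inl i))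

/-- The variable `y_j = e^{δ_j}`. -/
noncomputable def varY (n : ℕ) (j : Fin n) : CharField n :=
  algebraMap (MvPolynomial (Fin n ⊕ Fin n) ℤ) (CharField n) (MvPolynomial.X (Sum.inr j))

/-- `ch E(B)`, the Euler character of the diagram `(B, B)`. -/
noncomputable def chE (n : ℕ) (B : Finset ℤ) : CharField n :=
  eulerOfDiagram B B (varX n) (varY n)

/-- `ch K(A)`, the character of the Kac module of the diagram `(A, A)`, `|A| = n`. -/
noncomputable def chK (n : ℕ) (A : Finset ℤ) (hA : A.card = n) : CharField n :=
  kacOfDiagram A A hA hA (varX n) (varY n)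

/-- The character `y_1 ⋯ y_n / (x_1 ⋯ x_n)` of a one-dimensional module. -/
noncomputable def oneDimChar (n : ℕ) : CharField n :=
  (∏ j, varY n j) / ∏ i, varX n i

/-- The operator `T` induced on characters by the tensor product with the one-dimensional module
of character `y_1 ⋯ y_n / (x_1 ⋯ x_n)`. -/
noncomputable def T (n : ℕ) : CharField n →ₗ[ℤ] CharField n :=
  LinearMap.mulLeft ℤ (oneDimChar n)

/-- The shift `ω(x) = x - 1`, applied to all elements of a finite set of integers. -/
def omega (B : Finset ℤ) : Finset ℤ := B.image fun b => b - 1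

theorem card_omega (B : Finset ℤ) : (omega B).card = B.card :=
  Finset.card_image_of_injective B (sub_left_injective (b := (1 : ℤ)))

end GLSuper

namespace GLSuper

/-! ### Alternants, and the Euler character of `{0}`. -/

section Alternation

variable {F : Type*} [Field F]

/-! For Kac modules the factor `∏ y / ∏ x` is symmetric, so it enters both alternants and lowers
every `τ_i` by one while raising every `ν_j` by one; this is the shift `ω`.

For Euler characters with `p < n`, write `n = p + (m + 1)` and split each set of variables into a
head of length `p` and a tail of length `m + 1`. The elements of `ω(B)` are negative, so adjoining
`0` turns `τ` into `(0, τ)` and `ν` into `(ν, 0)`. A cycle of sign `(-1)^p`, applied to the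
x-variables of the term of `{0} ∪ ω(B)`, puts the first tail variable in front. Then all three terms
carry one common factor, `eulerPrefactor`, symmetric in the tail variables. Alternating over the
tails alone (`alternatePair_eq_zero_of_tail`) cancels it and leaves the case `B = ∅` for `𝔤𝔩(m + 1,
m + 1)`: the Euler character of `{0}` is `1 + (-1)^m ∏ y / ∏ x`. This is `alternatePair_single`, an
evaluation of Vandermonde-type determinants.

For `p = n` the tail is empty and the term of `{0} ∪ ω(B)` vanishes; for `p > n` everything
vanishes. -/

theorem alternate_congr {k : ℕ} {f g : (Fin k → F) → F} {x : Fin k → F}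
    (h : ∀ σ : Equiv.Perm (Fin k), f (x ∘ σ) = g (x ∘ σ)) : alternate f x = alternate g x :=
  Finset.sum_congr rfl fun σ _ => by rw [h]

theorem alternate_add {k : ℕ} (f g : (Fin k → F) → F) (x : Fin k → F) :
    alternate (fun u => f u + g u) x = alternate f x + alternate g x := by
  simp only [alternate, mul_add, Finset.sum_add_distrib]

theorem alternate_const_mul {k : ℕ} (c : F) (f : (Fin k → F) → F) (x : Fin k → F) :
    alternate (fun u => c * f u) x = c * alternate f x := by
  simp only [alternate, Finset.mul_sum]
  exact Finset.sum_congr rfl fun σ _ => by ring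

theorem prod_comp_perm {k : ℕ} (x : Fin k → F) (σ : Equiv.Perm (Fin k)) (f : F → F) :
    ∏ i, f ((x ∘ σ) i) = ∏ i, f (x i) :=
  Equiv.prod_comp σ fun i => f (x i)

/-- Reindexing the sum by `σ ↦ σ * c` costs the sign of `c`. -/
theorem alternate_comp_perm {k : ℕ} (c : Equiv.Perm (Fin k)) (f : (Fin k → F) → F)
    (x : Fin k → F) :
    alternate (fun u => f (u ∘ c)) x = ((Equiv.Perm.sign c : ℤ) : F) * alternate f x := by
  have hc : ((Equiv.Perm.sign c : ℤ) : F) * ((Equiv.Perm.sign c : ℤ) : F) = 1 := by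
    rw [← Int.cast_mul, Int.units_coe_mul_self, Int.cast_one]
  simp only [alternate, Finset.mul_sum]
  refine Fintype.sum_equiv (Equiv.mulRight c) _ _ fun σ => ?_
  simp only [Equiv.coe_mulRight, Equiv.Perm.sign_mul, Units.val_mul, Int.cast_mul,
    Equiv.Perm.coe_mul, Function.comp_assoc]
  linear_combination (-((Equiv.Perm.sign σ : ℤ) : F) * f (x ∘ σ ∘ c)) * hc

theorem alternate_prod_eq_det {k : ℕ} (q : Fin k → F → F) (x : Fin k → F) :
    alternate (fun u => ∏ i, q i (u i)) x = (Matrix.of fun i j => q j (x i)).det := by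
  simp [alternate, Matrix.det_apply']

open Polynomial in
-- Column operations remove the lower-order terms of monic polynomials of distinct degrees `0, …, k
-- - 1`. The sign of `Fin.revPerm` appears because the degrees decrease here but increase in the
-- Vandermonde matrix.
theorem alternate_prod_eval_monic {k : ℕ} (q : Fin k → F[X]) (hm : ∀ i, (q i).Monic)
    (hd : ∀ i, (q i).natDegree = k - 1 - (i : ℕ)) (x : Fin k → F) :
    alternate (fun u => ∏ i, (q i).eval (u i)) x =
      ((Equiv.Perm.sign (Fin.revPerm : Equiv.Perm (Fin k)) : ℤ) : F) *
        (Matrix.vandermonde x).det := by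
  rw [alternate_prod_eq_det (fun i a => (q i).eval a),
    Matrix.det_eval_matrixOfPolynomials_eq_det_vandermonde x (fun i => q (Fin.rev i)) ?_
      fun i => hm _, ← Matrix.det_permute']
  · congr 1
    ext i j
    simp
  · intro i
    rw [hd, Fin.val_rev]
    omega

open Polynomial in
-- Only the leading term `u_0 ^ m` of `q` survives the alternation.
theorem alternate_eval_mul_rhoMonomial_tail {m : ℕ} (q : F[X]) (hm : q.Monic)
    (hd : q.natDegree = m) (x : Fin (m + 1) → F) :
    alternate (fun u => q.eval (u 0) * rhoMonomial (Fin.tail u)) x = alternate rhoMonomial x := by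
  have h1 := alternate_prod_eval_monic (Fin.cons q fun i : Fin m => X ^ (m - 1 - (i : ℕ)))
    (by intro i; cases i using Fin.cases <;> simp [hm, monic_X_pow])
    (by
      intro i
      cases i using Fin.cases
      · simp [hd]
      · simp; omega) x
  have h2 := alternate_prod_eval_monic (fun i : Fin (m + 1) => (X : F[X]) ^ (m - (i : ℕ)))
    (fun i => monic_X_pow _) (by simp) x
  simp only [Fin.prod_univ_succ, Fin.cons_zero, Fin.cons_succ, eval_pow, eval_X] at h1
  simp only [eval_pow, eval_X] at h2
  exact h1.trans h2.symm

theorem rhoMonomial_succ {m : ℕ} (u : Fin (m + 1) → F) :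
    rhoMonomial u = u 0 ^ m * rhoMonomial (Fin.tail u) := by
  simp only [rhoMonomial, Fin.prod_univ_succ, Fin.tail]
  congr 1
  refine Finset.prod_congr rfl fun i _ => ?_
  rw [Fin.val_succ]
  congr 1
  omega

/-- Multiplying by the product of all variables turns the exponents `(-1, m - 1, …, 0)` into `(0, m,
…, 1)`, a rotation of `ρ`; the sign is that of an `(m + 1)`-cycle. -/
theorem alternate_inv_mul_rhoMonomial_tail {m : ℕ} (x : Fin (m + 1) → F) (hx : ∀ i, x i ≠ 0) :
    alternate (fun u => (u 0)⁻¹ * rhoMonomial (Fin.tail u)) x =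
      (-1) ^ m * (∏ i, x i)⁻¹ * alternate rhoMonomial x := by
  have h : ∀ σ : Equiv.Perm (Fin (m + 1)),
      ((x ∘ σ) 0)⁻¹ * rhoMonomial (Fin.tail (x ∘ σ)) =
        (∏ i, x i)⁻¹ * rhoMonomial ((x ∘ σ) ∘ finRotate (m + 1)) := by
    intro σ
    rw [← prod_comp_perm x σ fun a => a]
    have hu : ∀ i, (x ∘ σ) i ≠ 0 := fun i => hx _
    generalize x ∘ σ = u at hu
    have hp : ∏ i : Fin m, u i.succ ≠ 0 := Finset.prod_ne_zero_iff.2 fun i _ => hu _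
    have hr : rhoMonomial (u ∘ finRotate (m + 1)) =
        (∏ i : Fin m, u i.succ) * rhoMonomial (Fin.tail u) := by
      rw [rhoMonomial, Fin.prod_univ_castSucc, rhoMonomial, ← Finset.prod_mul_distrib]
      simp only [Fin.val_castSucc, Fin.val_last, add_tsub_cancel_right, Nat.sub_self, pow_zero,
        mul_one, Function.comp_apply, finRotate_apply, Fin.coeSucc_eq_succ, Fin.tail]
      refine Finset.prod_congr rfl fun i _ => ?_
      rw [← pow_succ']
      congr 1
      omega
    rw [hr, Fin.prod_univ_succ]
    field_simp [hu 0]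
  rw [alternate_congr (g := fun u => (∏ i, x i)⁻¹ * rhoMonomial (u ∘ finRotate (m + 1))) h,
    alternate_const_mul,
    alternate_comp_perm (finRotate (m + 1)) rhoMonomial, sign_finRotate]
  push_cast
  ring

open Polynomial in
theorem monic_prod_X_add_C {ι : Type*} [Fintype ι] (a : ι → F) :
    (∏ i, (X + C (a i))).Monic :=
  monic_prod_of_monic _ _ fun i _ => monic_X_add_C (a i)

open Polynomial in
theorem natDegree_prod_X_add_C {k : ℕ} (a : Fin k → F) :
    (∏ i, (X + C (a i))).natDegree = k := by
  rw [natDegree_prod_of_monic _ _ fun i _ => monic_X_add_C (a i)]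
  simp

/-- The alternation in `y` for the case of a single distinguished pair of variables. -/
theorem alternate_prod_one_add_div {m : ℕ} (a : Fin m → F) (y : Fin (m + 1) → F)
    (hy : ∀ i, y i ≠ 0) :
    alternate (fun v => (∏ i, (1 + a i / v 0)) * rhoMonomial v) y = alternate rhoMonomial y := by
  rw [← alternate_eval_mul_rhoMonomial_tail _ (monic_prod_X_add_C a) (natDegree_prod_X_add_C a)]
  refine alternate_congr fun σ => ?_
  have h0 : (y ∘ σ) 0 ≠ 0 := hy _
  -- The `m` denominators exactly use up the power of the first variable in `ρ`.
  have : (∏ i, (1 + a i / (y ∘ σ) 0)) * (y ∘ σ) 0 ^ m = ∏ i, ((y ∘ σ) 0 + a i) := by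
    rw [← Fin.prod_const, ← Finset.prod_mul_distrib]
    exact Finset.prod_congr rfl fun i _ => by field_simp
  simp only [rhoMonomial_succ, Polynomial.eval_prod, Polynomial.eval_add, Polynomial.eval_X,
    Polynomial.eval_C, ← this]
  ring

/-- The alternation in `x` for the case of a single distinguished pair of variables. -/
theorem alternate_prod_one_add_div_zero {m : ℕ} (b x : Fin (m + 1) → F) (hx : ∀ i, x i ≠ 0) :
    alternate (fun u => (∏ j, (1 + b j / u 0)) * rhoMonomial u) x =
      (1 + (-1) ^ m * ((∏ j, b j) / ∏ i, x i)) * alternate rhoMonomial x := by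
  -- Here there are `m + 1` denominators against `u_0 ^ m`, so `h(u_0) / u_0` remains. Its
  -- polynomial part `h.divX` is monic of degree `m` and gives the summand `1`; the constant term `∏
  -- b_j`, over `u_0`, gives the other summand.
  set h : Polynomial F := ∏ j, (Polynomial.X + Polynomial.C (b j)) with hh
  have hdeg : h.natDegree = m + 1 := natDegree_prod_X_add_C b
  have hdX : h.divX.natDegree = m := by
    rw [Polynomial.natDegree_divX_eq_natDegree_tsub_one, hdeg, Nat.add_sub_cancel]
  have hmon : h.divX.Monic := by
    have : h.Monic := monic_prod_X_add_C b
    rw [Polynomial.Monic, Polynomial.leadingCoeff, hdX, Polynomial.coeff_divX, ← hdeg]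
    exact this
  have h0 : h.coeff 0 = ∏ j, b j := by
    rw [Polynomial.coeff_zero_eq_eval_zero, hh]
    simp [Polynomial.eval_prod]
  have key : ∀ σ : Equiv.Perm (Fin (m + 1)),
      (∏ j, (1 + b j / (x ∘ σ) 0)) * rhoMonomial (x ∘ σ) =
        h.divX.eval ((x ∘ σ) 0) * rhoMonomial (Fin.tail (x ∘ σ)) +
          (∏ j, b j) * (((x ∘ σ) 0)⁻¹ * rhoMonomial (Fin.tail (x ∘ σ))) := by
    intro σ
    have hz : (x ∘ σ) 0 ≠ 0 := hx _
    generalize x ∘ σ = u at hz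
    have h1 : (∏ j, (1 + b j / u 0)) * u 0 ^ (m + 1) = ∏ j, (u 0 + b j) := by
      rw [← Fin.prod_const, ← Finset.prod_mul_distrib]
      exact Finset.prod_congr rfl fun i _ => by field_simp
    have h2 : ∏ j, (u 0 + b j) = h.divX.eval (u 0) * u 0 + ∏ j, b j := by
      have := congrArg (Polynomial.eval (u 0)) (Polynomial.divX_mul_X_add h)
      rw [Polynomial.eval_add, Polynomial.eval_mul, Polynomial.eval_X, Polynomial.eval_C, h0] at this
      rw [this, hh]
      simp [Polynomial.eval_prod]
    rw [rhoMonomial_succ]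
    have h3 : (∏ j, (1 + b j / u 0)) * u 0 ^ m =
        h.divX.eval (u 0) + (∏ j, b j) * (u 0)⁻¹ := by
      rw [← mul_left_inj' hz, add_mul, mul_assoc _ (u 0)⁻¹, inv_mul_cancel₀ hz, mul_one, ← h2, ← h1]
      ring
    rw [← mul_assoc, h3]
    ring
  rw [alternate_congr (g := fun u => h.divX.eval (u 0) * rhoMonomial (Fin.tail u) +
      (∏ j, b j) * ((u 0)⁻¹ * rhoMonomial (Fin.tail u))) key, alternate_add, alternate_const_mul,
    alternate_eval_mul_rhoMonomial_tail _ hmon hdX, alternate_inv_mul_rhoMonomial_tail x hx]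
  ring

theorem alternatePair_eq {m n : ℕ} (f : (Fin m → F) → (Fin n → F) → F)
    (x : Fin m → F) (y : Fin n → F) :
    alternatePair f x y = alternate (fun u => alternate (f u) y) x := by
  simp only [alternatePair, alternate, Finset.mul_sum, mul_assoc]

theorem alternatePair_congr {m n : ℕ} {f g : (Fin m → F) → (Fin n → F) → F}
    {x : Fin m → F} {y : Fin n → F}
    (h : ∀ (σ : Equiv.Perm (Fin m)) (τ : Equiv.Perm (Fin n)),
      f (x ∘ σ) (y ∘ τ) = g (x ∘ σ) (y ∘ τ)) :
    alternatePair f x y = alternatePair g x y :=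
  Finset.sum_congr rfl fun σ _ => Finset.sum_congr rfl fun τ _ => by rw [h]

theorem alternatePair_sub {m n : ℕ} (f g : (Fin m → F) → (Fin n → F) → F)
    (x : Fin m → F) (y : Fin n → F) :
    alternatePair (fun u v => f u v - g u v) x y = alternatePair f x y - alternatePair g x y := by
  simp only [alternatePair, mul_sub, Finset.sum_sub_distrib]

theorem alternatePair_const_mul {m n : ℕ} (c : F) (f : (Fin m → F) → (Fin n → F) → F)
    (x : Fin m → F) (y : Fin n → F) :
    alternatePair (fun u v => c * f u v) x y = c * alternatePair f x y := by
  simp only [alternatePair, Finset.mul_sum]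
  exact Finset.sum_congr rfl fun σ _ => Finset.sum_congr rfl fun τ _ => by ring

theorem alternatePair_comp_perm_left {m n : ℕ} (c : Equiv.Perm (Fin m))
    (f : (Fin m → F) → (Fin n → F) → F) (x : Fin m → F) (y : Fin n → F) :
    alternatePair (fun u v => f (u ∘ c) v) x y =
      ((Equiv.Perm.sign c : ℤ) : F) * alternatePair f x y := by
  rw [alternatePair_eq, alternatePair_eq,
    ← alternate_comp_perm c (fun u => alternate (f u) y)]

theorem alternatePair_rhoMonomial {m n : ℕ} (x : Fin m → F) (y : Fin n → F) :
    alternatePair (fun u v => rhoMonomial u * rhoMonomial v) x y =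
      alternate rhoMonomial x * alternate rhoMonomial y := by
  rw [alternatePair_eq, mul_comm, ← alternate_const_mul]
  exact alternate_congr fun σ => by rw [alternate_const_mul, mul_comm]

/-- The numerator of the Euler character of the diagram `{0}` for `𝔤𝔩(m + 1, m + 1)`. -/
theorem alternatePair_single {m : ℕ} (x y : Fin (m + 1) → F) (hx : ∀ i, x i ≠ 0)
    (hy : ∀ i, y i ≠ 0) :
    alternatePair (fun u v => (∏ j, (1 + v j / u 0)) * (∏ i : Fin m, (1 + u i.succ / v 0)) *
        (rhoMonomial u * rhoMonomial v)) x y =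
      (1 + (-1) ^ m * ((∏ j, y j) / ∏ i, x i)) *
        (alternate rhoMonomial x * alternate rhoMonomial y) := by
  rw [alternatePair_eq, ← mul_assoc, ← alternate_prod_one_add_div_zero y x hx, mul_comm,
    ← alternate_const_mul]
  refine alternate_congr fun σ => ?_
  rw [← alternate_prod_one_add_div (fun i : Fin m => (x ∘ σ) i.succ) y hy, mul_comm,
    ← alternate_const_mul]
  refine alternate_congr fun τ => ?_
  rw [prod_comp_perm y τ fun a => 1 + a / (x ∘ σ) 0]
  ring

end Alternation

/-! ### Alternating over the last `k` variables. -/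

section Tail

/-- The permutation of `Fin (p + k)` that permutes the last `k` indices by `h`. -/
def permTail (p : ℕ) {k : ℕ} (h : Equiv.Perm (Fin k)) : Equiv.Perm (Fin (p + k)) :=
  finSumFinEquiv.permCongr (Equiv.Perm.sumCongr 1 h)

theorem sign_permTail (p : ℕ) {k : ℕ} (h : Equiv.Perm (Fin k)) :
    Equiv.Perm.sign (permTail p h) = Equiv.Perm.sign h := by
  rw [permTail, Equiv.Perm.sign_permCongr, Equiv.Perm.sign_sumCongr, Equiv.Perm.sign_one, one_mul]

theorem append_comp_permTail {α : Type*} {p k : ℕ} (a : Fin p → α) (b : Fin k → α)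
    (h : Equiv.Perm (Fin k)) : Fin.append a b ∘ permTail p h = Fin.append a (b ∘ h) := by
  ext i
  cases i using Fin.addCases <;> simp [permTail, Equiv.permCongr_apply]

variable {F : Type*} [Field F]

theorem alternatePair_comp_perm_right {m n : ℕ} (c : Equiv.Perm (Fin n))
    (f : (Fin m → F) → (Fin n → F) → F) (x : Fin m → F) (y : Fin n → F) :
    alternatePair (fun u v => f u (v ∘ c)) x y =
      ((Equiv.Perm.sign c : ℤ) : F) * alternatePair f x y := by
  rw [alternatePair_eq, alternatePair_eq, ← alternate_const_mul]
  exact alternate_congr fun σ => alternate_comp_perm c _ y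

/-- Averaging over the subgroup `S_k × S_k` of permutations of the tails: the signed sum of its
translates of `g` multiplies the full alternation by `(k!)²`, which is nonzero in characteristic
zero, and each inner sum is zero by `H`. -/
theorem alternatePair_eq_zero_of_tail [CharZero F] {p k : ℕ}
    (g : (Fin (p + k) → F) → (Fin (p + k) → F) → F) (x y : Fin (p + k) → F)
    (hx : ∀ i, x i ≠ 0) (hy : ∀ i, y i ≠ 0)
    (H : ∀ (a c : Fin p → F) (b d : Fin k → F), (∀ i, a i ≠ 0) → (∀ i, c i ≠ 0) →
      (∀ i, b i ≠ 0) → (∀ i, d i ≠ 0) →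
      alternatePair (fun u v => g (Fin.append a u) (Fin.append c v)) b d = 0) :
    alternatePair g x y = 0 := by
  have hsq : ∀ h : Equiv.Perm (Fin k),
      ((Equiv.Perm.sign h : ℤ) : F) * ((Equiv.Perm.sign h : ℤ) : F) = 1 := fun h => by
    rw [← Int.cast_mul, Int.units_coe_mul_self, Int.cast_one]
  have h1 : ∀ h h' : Equiv.Perm (Fin k), alternatePair g x y =
      ((Equiv.Perm.sign h : ℤ) : F) * ((Equiv.Perm.sign h' : ℤ) : F) *
        alternatePair (fun u v => g (u ∘ permTail p h) (v ∘ permTail p h')) x y := by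
    intro h h'
    rw [alternatePair_comp_perm_left (permTail p h) fun u v => g u (v ∘ permTail p h'),
      alternatePair_comp_perm_right, sign_permTail, sign_permTail]
    linear_combination (-alternatePair g x y) * hsq h -
      ((Equiv.Perm.sign h : ℤ) : F) * ((Equiv.Perm.sign h : ℤ) : F) * alternatePair g x y * hsq h'
  have h2 : ∑ h : Equiv.Perm (Fin k), ∑ h' : Equiv.Perm (Fin k),
      ((Equiv.Perm.sign h : ℤ) : F) * ((Equiv.Perm.sign h' : ℤ) : F) *
        alternatePair (fun u v => g (u ∘ permTail p h) (v ∘ permTail p h')) x y =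
      alternatePair (fun u v => alternatePair
        (fun b d => g (Fin.append (fun i => u (Fin.castAdd k i)) b)
          (Fin.append (fun i => v (Fin.castAdd k i)) d))
        (fun i => u (Fin.natAdd p i)) (fun i => v (Fin.natAdd p i))) x y := by
    have h3 : ∀ (u : Fin (p + k) → F) (h : Equiv.Perm (Fin k)), u ∘ permTail p h =
        Fin.append (fun i => u (Fin.castAdd k i)) ((fun i => u (Fin.natAdd p i)) ∘ h) := by
      intro u h
      rw [← append_comp_permTail, Fin.append_castAdd_natAdd]
    simp only [h3, ← alternatePair_const_mul]
    simp only [alternatePair, Finset.mul_sum]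
    simp_rw [Finset.sum_comm (s := (univ : Finset (Equiv.Perm (Fin k))))
      (t := (univ : Finset (Equiv.Perm (Fin (p + k)))))]
  have h4 : ∑ _h : Equiv.Perm (Fin k), ∑ _h' : Equiv.Perm (Fin k), alternatePair g x y = 0 := by
    rw [Finset.sum_congr rfl fun h _ => Finset.sum_congr rfl fun h' _ => h1 h h', h2]
    refine Finset.sum_eq_zero fun σ _ => Finset.sum_eq_zero fun τ _ => ?_
    exact mul_eq_zero_of_right _
      (H _ _ _ _ (fun i => hx _) (fun i => hy _) (fun i => hx _) fun i => hy _)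
  simpa using h4

theorem eulerTerm_append {n r k : ℕ} (h : n = r + k) (hr : r ≤ n) (τ ν : Fin r → ℤ)
    (a c : Fin r → F) (b d : Fin k → F) :
    eulerTerm hr hr τ ν (Fin.append a b ∘ Fin.cast h) (Fin.append c d ∘ Fin.cast h) =
      (∏ i, ((∏ j, (1 + c j / a i)) * ∏ j, (1 + d j / a i))) * (∏ i, ∏ j, (1 + b i / c j)) *
      (∏ i, a i ^ τ i) * (∏ j, c j ^ ν j) *
      ((∏ i, a i ^ (n - 1 - (i : ℕ))) * rhoMonomial b) *
      ((∏ j, c j ^ (n - 1 - (j : ℕ))) * rhoMonomial d) := by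
  subst h
  have hcast : ∀ i : Fin r, Fin.castLE hr i = Fin.castAdd k i := fun _ => rfl
  have hrho : ∀ (a : Fin r → F) (b : Fin k → F), rhoMonomial (Fin.append a b) =
      (∏ i, a i ^ (r + k - 1 - (i : ℕ))) * rhoMonomial b := by
    intro a b
    simp only [rhoMonomial, Fin.prod_univ_add, Fin.append_left, Fin.append_right, Fin.val_castAdd,
      Fin.val_natAdd]
    congr 1
    refine Finset.prod_congr rfl fun i _ => ?_
    congr 1
    omega
  simp only [eulerTerm, Fin.cast_refl, Function.comp_id, hcast, hrho, Fin.append_left,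
    Finset.prod_filter]
  congr 5
  · exact Finset.prod_congr rfl fun i _ => by
      simp only [Fin.prod_univ_add, Fin.append_left, Fin.append_right]
  · rw [Fin.prod_univ_add, Finset.prod_eq_one fun i _ => if_neg (by simp), one_mul]
    simp

end Tail

/-- For the x-variables: the weight `(0, τ)` has its new entry in front, so the first tail variable
has to move past the whole head. -/
theorem append_comp_cycleRange_symm {α : Type*} {p m : ℕ} (a : Fin p → α) (b : Fin (m + 1) → α)
    (h : p + (m + 1) = p + 1 + m) :
    Fin.append a b ∘ (Fin.cycleRange (⟨p, by omega⟩ : Fin (p + m + 1))).symm =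
      Fin.append (Fin.cons (b 0) a : Fin (p + 1) → α) (Fin.tail b) ∘ Fin.cast h := by
  funext i
  cases i using Fin.cases (n := p + m) with
  | zero =>
    rw [Function.comp_apply, Fin.cycleRange_symm_zero, Function.comp_apply]
    exact (Fin.append_right a b 0).trans (Fin.append_left (Fin.cons (b 0) a) (Fin.tail b) 0).symm
  | succ j =>
    rw [Function.comp_apply, Fin.cycleRange_symm_succ, Function.comp_apply]
    cases j using Fin.addCases with
    | left j =>
      rw [Fin.succAbove_of_castSucc_lt _ _ (by simp [Fin.lt_def])]
      exact (Fin.append_left a b j).trans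
        (Fin.append_left (Fin.cons (b 0) a : Fin (p + 1) → α) (Fin.tail b) j.succ).symm
    | right j =>
      rw [Fin.succAbove_of_le_castSucc _ _ (by simp [Fin.le_def])]
      refine (Fin.append_right a b j.succ).trans ?_
      rw [show Fin.cast h (Fin.natAdd p j).succ = Fin.natAdd (p + 1) j from
        Fin.ext (by simp; omega), Fin.append_right]
      rfl

/-- For the y-variables no permutation is needed, since `(ν, 0)` has its new entry at the end. -/
theorem append_eq_append_snoc_tail {α : Type*} {p m : ℕ} (c : Fin p → α) (d : Fin (m + 1) → α)
    (h : p + (m + 1) = p + 1 + m) :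
    Fin.append c d = Fin.append (Fin.snoc c (d 0) : Fin (p + 1) → α) (Fin.tail d) ∘ Fin.cast h := by
  funext i
  cases i using Fin.addCases with
  | left j =>
    rw [Fin.append_left, Function.comp_apply, show Fin.cast h (Fin.castAdd (m + 1) j) =
      Fin.castAdd m j.castSucc from rfl, Fin.append_left, Fin.snoc_castSucc]
  | right j =>
    rw [Fin.append_right, Function.comp_apply]
    cases j using Fin.cases with
    | zero =>
      rw [show Fin.cast h (Fin.natAdd p 0) = Fin.castAdd m (Fin.last p) from rfl,
        Fin.append_left, Fin.snoc_last]
    | succ j =>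
      rw [show Fin.cast h (Fin.natAdd p j.succ) = Fin.natAdd (p + 1) j from
        Fin.ext (by simp; omega), Fin.append_right]
      rfl

/-! ### The recursion for the numerators of Euler characters. -/

section Recursion

variable {F : Type*} [Field F]

/-- The part of the expression defining the Euler character of `ω(B)` that is symmetric in the last
`k` variables `b` and in the last `k` variables `d`. -/
def eulerPrefactor {p k : ℕ} (τ ν : Fin p → ℤ) (a c : Fin p → F) (b d : Fin k → F) : F :=
  (∏ i, ((∏ j, (1 + c j / a i)) * ∏ j, (1 + d j / a i))) * (∏ i, ∏ j, (1 + b i / c j)) *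
    (∏ i, a i ^ (τ i - 1)) * (∏ j, c j ^ (ν j + 1)) *
    (∏ i, a i ^ (p + k - 1 - (i : ℕ))) * (∏ j, c j ^ (p + k - 1 - (j : ℕ)))

theorem eulerPrefactor_comp_perm {p k : ℕ} (τ ν : Fin p → ℤ) (a c : Fin p → F) (b d : Fin k → F)
    (σ ρ : Equiv.Perm (Fin k)) :
    eulerPrefactor τ ν a c (b ∘ σ) (d ∘ ρ) = eulerPrefactor τ ν a c b d := by
  simp only [eulerPrefactor]
  congr 5
  · exact Finset.prod_congr rfl fun i _ => by rw [prod_comp_perm d ρ fun z => 1 + z / a i]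
  · exact prod_comp_perm b σ fun z => ∏ j, (1 + z / c j)

theorem eulerTerm_omega_append {p k : ℕ} (hp : p ≤ p + k) (τ ν : Fin p → ℤ) (a c : Fin p → F)
    (b d : Fin k → F) :
    eulerTerm hp hp (fun i => τ i - 1) (fun j => ν j + 1) (Fin.append a b) (Fin.append c d) =
      eulerPrefactor τ ν a c b d * (rhoMonomial b * rhoMonomial d) := by
  refine (eulerTerm_append rfl hp _ _ a c b d).trans ?_
  rw [eulerPrefactor]
  ring

theorem eulerTerm_append_mul {p k : ℕ} (hp : p ≤ p + k) (τ ν : Fin p → ℤ) (a c : Fin p → F)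
    (b d : Fin k → F) (ha : ∀ i, a i ≠ 0) (hc : ∀ i, c i ≠ 0) :
    (∏ j, Fin.append c d j) / (∏ i, Fin.append a b i) *
        eulerTerm hp hp τ ν (Fin.append a b) (Fin.append c d) =
      eulerPrefactor τ ν a c b d *
        ((∏ j, d j) / (∏ i, b i) * (rhoMonomial b * rhoMonomial d)) := by
  have h1 : ∏ i, a i ^ (τ i - 1) = (∏ i, a i ^ τ i) / ∏ i, a i := by
    rw [← Finset.prod_div_distrib]
    exact Finset.prod_congr rfl fun i _ => by rw [zpow_sub_one₀ (ha i), div_eq_mul_inv]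
  have h2 : ∏ i, c i ^ (ν i + 1) = (∏ i, c i ^ ν i) * ∏ i, c i := by
    rw [← Finset.prod_mul_distrib]
    exact Finset.prod_congr rfl fun i _ => zpow_add_one₀ (hc i) _
  have h3 : eulerTerm hp hp τ ν (Fin.append a b) (Fin.append c d) = _ :=
    eulerTerm_append rfl hp τ ν a c b d
  rw [h3, eulerPrefactor, h1, h2]
  simp only [Fin.prod_univ_add, Fin.append_left, Fin.append_right]
  simp only [div_eq_mul_inv, mul_inv]
  ring

theorem eulerTerm_insert_append {p m : ℕ} (hp : p + 1 ≤ p + (m + 1)) (τ ν : Fin p → ℤ)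
    (a c : Fin p → F) (b d : Fin (m + 1) → F) (ha : ∀ i, a i ≠ 0) (hc : ∀ i, c i ≠ 0)
    (hb : ∀ i, b i ≠ 0) :
    eulerTerm hp hp (Fin.cons 0 τ : Fin (p + 1) → ℤ) (Fin.snoc ν 0 : Fin (p + 1) → ℤ)
        (Fin.append a b ∘ (Fin.cycleRange (⟨p, by omega⟩ : Fin (p + m + 1))).symm)
        (Fin.append c d) =
      eulerPrefactor τ ν a c b d * ((∏ j, (1 + d j / b 0)) * (∏ i : Fin m, (1 + b i.succ / d 0)) *
        (rhoMonomial b * rhoMonomial d)) := by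
  have hn : p + (m + 1) = p + 1 + m := by omega
  rw [append_comp_cycleRange_symm a b hn, append_eq_append_snoc_tail c d hn, eulerTerm_append hn]
  have hA : ∀ w : F, ∏ j, (1 + (Fin.snoc c (d 0) : Fin (p + 1) → F) j / w) =
      (∏ j, (1 + c j / w)) * (1 + d 0 / w) := by simp [Fin.prod_univ_castSucc]
  have hB : ∀ w : F, ∏ j, (1 + w / (Fin.snoc c (d 0) : Fin (p + 1) → F) j) =
      (∏ j, (1 + w / c j)) * (1 + w / d 0) := by simp [Fin.prod_univ_castSucc]
  have hC : ∏ j, (Fin.snoc c (d 0) : Fin (p + 1) → F) j ^ (Fin.snoc ν 0 : Fin (p + 1) → ℤ) j =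
      ∏ j, c j ^ ν j := by simp [Fin.prod_univ_castSucc]
  have hD : ∏ j, (Fin.snoc c (d 0) : Fin (p + 1) → F) j ^ (p + (m + 1) - 1 - (j : ℕ)) =
      (∏ j : Fin p, c j ^ (p + (m + 1) - 1 - (j : ℕ))) * d 0 ^ m := by
    simp [Fin.prod_univ_castSucc]
  simp only [hA, hB, hC, hD]
  simp only [Fin.prod_univ_succ (n := p), Fin.cons_zero, Fin.cons_succ, zpow_zero, one_mul,
    Fin.tail, Fin.val_zero, Fin.val_succ]
  -- From `1 + c / b = (1 + b / c) * (c / b)`: the factors of the moved variable become those of a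
  -- tail variable, its power drops from `p + m` to `m`, and the extra `∏ c_j` raises each `ν_j` by
  -- one.
  have h1 : (∏ j, (1 + c j / b 0)) * b 0 ^ (p + (m + 1) - 1 - 0) =
      (∏ j, (1 + b 0 / c j)) * (∏ j, c j) * b 0 ^ m := by
    rw [show p + (m + 1) - 1 - 0 = p + m by omega, pow_add, ← mul_assoc, ← Fin.prod_const,
      ← Finset.prod_mul_distrib, ← Finset.prod_mul_distrib]
    congr 1
    refine Finset.prod_congr rfl fun j _ => ?_
    field_simp [hb 0, hc j]
    ring
  -- Each head variable has moved one place to the right, so its `ρ`-exponent drops by one; this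
  -- matches `τ_i - 1`.
  have h2 : (∏ i, a i ^ τ i) * (∏ i : Fin p, a i ^ (p + (m + 1) - 1 - ((i : ℕ) + 1))) =
      (∏ i, a i ^ (τ i - 1)) * ∏ i : Fin p, a i ^ (p + (m + 1) - 1 - (i : ℕ)) := by
    rw [← Finset.prod_mul_distrib, ← Finset.prod_mul_distrib]
    refine Finset.prod_congr rfl fun i _ => ?_
    rw [← zpow_natCast, ← zpow_natCast, ← zpow_add₀ (ha i), ← zpow_add₀ (ha i)]
    congr 1
    omega
  have h3 : ∏ i, c i ^ (ν i + 1) = (∏ i, c i ^ ν i) * ∏ i, c i := by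
    rw [← Finset.prod_mul_distrib]
    exact Finset.prod_congr rfl fun i _ => zpow_add_one₀ (hc i) _
  rw [eulerPrefactor, h3, rhoMonomial_succ b, rhoMonomial_succ d]
  simp only [Fin.prod_univ_succ (n := m), Finset.prod_mul_distrib, Fin.tail_def]
  have h4 := congrArg₂ (· * ·) h1 h2
  linear_combination ((1 + d 0 / b 0) * (∏ i : Fin m, (1 + d i.succ / b 0)) *
    (∏ i, ∏ j, (1 + c j / a i)) * (∏ i, (1 + d 0 / a i)) * (∏ i, ∏ j : Fin m, (1 + d j.succ / a i)) *
    (∏ i : Fin m, ∏ j, (1 + b i.succ / c j)) * (∏ i : Fin m, (1 + b i.succ / d 0)) *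
    (∏ j, c j ^ ν j) * rhoMonomial (fun i : Fin m => b i.succ) *
    (∏ j : Fin p, c j ^ (p + (m + 1) - 1 - (j : ℕ))) * d 0 ^ m *
    rhoMonomial (fun i : Fin m => d i.succ)) * h4

theorem alternatePair_eulerTerm_recursion [CharZero F] {p m : ℕ} (h1 : p ≤ p + (m + 1))
    (h2 : p + 1 ≤ p + (m + 1)) (τ ν : Fin p → ℤ) (x y : Fin (p + (m + 1)) → F)
    (hx : ∀ i, x i ≠ 0) (hy : ∀ i, y i ≠ 0) :
    (∏ j, y j) / (∏ i, x i) * alternatePair (eulerTerm h1 h1 τ ν) x y =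
      (-1) ^ (p + (m + 1) + p) *
        (alternatePair (eulerTerm h1 h1 (fun i => τ i - 1) (fun j => ν j + 1)) x y -
          (-1) ^ p * alternatePair (eulerTerm h2 h2 (Fin.cons 0 τ : Fin (p + 1) → ℤ)
            (Fin.snoc ν 0 : Fin (p + 1) → ℤ)) x y) := by
  set cyc : Equiv.Perm (Fin (p + (m + 1))) :=
    (Fin.cycleRange (⟨p, by omega⟩ : Fin (p + m + 1))).symm with hcyc
  have hsign : ((Equiv.Perm.sign cyc : ℤ) : F) = (-1) ^ p := by
    rw [hcyc, Equiv.Perm.sign_symm, Fin.sign_cycleRange]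
    push_cast
    rfl
  have hpow : (-1 : F) ^ (p + (m + 1) + p) = (-1) ^ (m + 1) := by
    rw [show p + (m + 1) + p = 2 * p + (m + 1) by ring, pow_add, pow_mul]
    simp
  have hL : (∏ j, y j) / (∏ i, x i) * alternatePair (eulerTerm h1 h1 τ ν) x y =
      alternatePair (fun u v => (∏ j, v j) / (∏ i, u i) * eulerTerm h1 h1 τ ν u v) x y := by
    rw [← alternatePair_const_mul]
    exact alternatePair_congr fun σ ρ => by
      rw [prod_comp_perm x σ fun z => z, prod_comp_perm y ρ fun z => z]
  -- The sign `(-1)^p` is absorbed as the sign of the cycle, so that the identity becomes the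
  -- vanishing of a single alternation.
  rw [hL, ← hsign, ← alternatePair_comp_perm_left, ← alternatePair_sub, hpow,
    ← alternatePair_const_mul, ← sub_eq_zero, ← alternatePair_sub]
  refine alternatePair_eq_zero_of_tail _ x y hx hy fun a c b d ha hc hb hd => ?_
  have hpt : ∀ σ ρ : Equiv.Perm (Fin (m + 1)),
      (∏ j, Fin.append c (d ∘ ρ) j) / (∏ i, Fin.append a (b ∘ σ) i) *
        eulerTerm h1 h1 τ ν (Fin.append a (b ∘ σ)) (Fin.append c (d ∘ ρ)) -
      (-1) ^ (m + 1) * (eulerTerm h1 h1 (fun i => τ i - 1) (fun j => ν j + 1)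
          (Fin.append a (b ∘ σ)) (Fin.append c (d ∘ ρ)) -
        eulerTerm h2 h2 (Fin.cons 0 τ : Fin (p + 1) → ℤ) (Fin.snoc ν 0 : Fin (p + 1) → ℤ)
          (Fin.append a (b ∘ σ) ∘ cyc) (Fin.append c (d ∘ ρ))) =
      eulerPrefactor τ ν a c b d *
        (((∏ j, d j) / (∏ i, b i) - (-1) ^ (m + 1)) *
            (rhoMonomial (b ∘ σ) * rhoMonomial (d ∘ ρ)) -
          (-1) ^ m * ((∏ j, (1 + (d ∘ ρ) j / (b ∘ σ) 0)) *
            (∏ i : Fin m, (1 + (b ∘ σ) i.succ / (d ∘ ρ) 0)) *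
            (rhoMonomial (b ∘ σ) * rhoMonomial (d ∘ ρ)))) := by
    intro σ ρ
    rw [eulerTerm_append_mul h1 τ ν a c _ _ ha hc, eulerTerm_omega_append,
      eulerTerm_insert_append h2 τ ν a c (b ∘ σ) _ ha hc fun i => hb _, eulerPrefactor_comp_perm,
      prod_comp_perm b σ fun z => z, prod_comp_perm d ρ fun z => z]
    ring
  rw [alternatePair_congr (g := fun u v => eulerPrefactor τ ν a c b d *
        (((∏ j, d j) / (∏ i, b i) - (-1) ^ (m + 1)) * (rhoMonomial u * rhoMonomial v) -
          (-1) ^ m * ((∏ j, (1 + v j / u 0)) * (∏ i : Fin m, (1 + u i.succ / v 0)) *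
            (rhoMonomial u * rhoMonomial v)))) hpt,
    alternatePair_const_mul, alternatePair_sub, alternatePair_const_mul, alternatePair_const_mul,
    alternatePair_single b d hb hd, alternatePair_rhoMonomial]
  have hm : ((-1 : F) ^ m) * (-1) ^ m = 1 := by rw [← mul_pow]; simp
  linear_combination (-(eulerPrefactor τ ν a c b d * ((∏ j, d j) / (∏ i, b i)) *
    (alternate rhoMonomial b * alternate rhoMonomial d))) * hm

end Recursion

/-! ### Weights of the diagrams `ω(B)` and `{0} ∪ ω(B)`. -/

theorem eulerOfDiagram_self {F : Type*} [Field F] {n p : ℕ} (B : Finset ℤ) (hB : B.card = p)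
    (hp : p ≤ n) (x y : Fin n → F) :
    eulerOfDiagram B B x y =
      eulerOfWeight hp hp (fun i : Fin p => B.orderEmbOfFin hB (Fin.rev i) + (i : ℤ))
        (fun j : Fin p => (j : ℤ) + 1 - (p : ℤ) - B.orderEmbOfFin hB j) x y := by
  subst hB
  rw [eulerOfDiagram, dif_pos ⟨hp, hp⟩]
  rfl

theorem eulerOfDiagram_self_of_lt {F : Type*} [Field F] {n : ℕ} (B : Finset ℤ)
    (h : n < B.card) (x y : Fin n → F) : eulerOfDiagram B B x y = 0 :=
  dif_neg fun h' => absurd h'.1 (by omega)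

theorem orderEmbOfFin_omega {B : Finset ℤ} {p : ℕ} (hB : B.card = p) (hB' : (omega B).card = p)
    (i : Fin p) : (omega B).orderEmbOfFin hB' i = B.orderEmbOfFin hB i - 1 := by
  refine (congrFun (Finset.orderEmbOfFin_unique hB'
    (f := fun i => B.orderEmbOfFin hB i - 1) (fun i => ?_) fun i j hij => ?_) i).symm
  · exact Finset.mem_image_of_mem _ (Finset.orderEmbOfFin_mem B hB i)
  · exact sub_lt_sub_right ((B.orderEmbOfFin hB).strictMono hij) 1

theorem zero_notMem_omega {B : Finset ℤ} (h : ∀ b ∈ B, b ≤ 0) : (0 : ℤ) ∉ omega B := by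
  intro h0
  obtain ⟨b, hb, hb'⟩ := Finset.mem_image.1 h0
  have := h b hb
  omega

theorem card_zero_union_omega {B : Finset ℤ} (h : ∀ b ∈ B, b ≤ 0) :
    ({0} ∪ omega B).card = B.card + 1 := by
  rw [Finset.singleton_union, Finset.card_insert_of_notMem (zero_notMem_omega h), card_omega]

/-- Since `B` has no positive elements, those of `ω(B)` are at most `-1`, and `0` comes last in
increasing order. -/
theorem orderEmbOfFin_zero_union_omega {B : Finset ℤ} (h : ∀ b ∈ B, b ≤ 0) {p : ℕ}
    (hB : B.card = p) (hB' : ({0} ∪ omega B).card = p + 1) :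
    ({0} ∪ omega B).orderEmbOfFin hB' =
      (Fin.snoc (fun i : Fin p => B.orderEmbOfFin hB i - 1) 0 : Fin (p + 1) → ℤ) := by
  refine (Finset.orderEmbOfFin_unique hB' (fun i => ?_) fun i j hij => ?_).symm
  · cases i using Fin.lastCases with
    | last => simp
    | cast i =>
      rw [Fin.snoc_castSucc]
      exact Finset.mem_union_right _
        (Finset.mem_image_of_mem _ (Finset.orderEmbOfFin_mem B hB i))
  · cases i using Fin.lastCases with
    | last => exact absurd hij (not_lt.2 (Fin.le_last j))
    | cast i =>
      cases j using Fin.lastCases with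
      | last =>
        rw [Fin.snoc_castSucc, Fin.snoc_last]
        have := h _ (Finset.orderEmbOfFin_mem B hB i)
        omega
      | cast j =>
        rw [Fin.snoc_castSucc, Fin.snoc_castSucc]
        exact sub_lt_sub_right ((B.orderEmbOfFin hB).strictMono (by simpa using hij)) 1

theorem xWeight_zero_union_omega {B : Finset ℤ} (h : ∀ b ∈ B, b ≤ 0) {p : ℕ}
    (hB : B.card = p) (hB' : ({0} ∪ omega B).card = p + 1) :
    (fun i : Fin (p + 1) => ({0} ∪ omega B).orderEmbOfFin hB' (Fin.rev i) + (i : ℤ)) =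
      Fin.cons 0 fun i => B.orderEmbOfFin hB (Fin.rev i) + (i : ℤ) := by
  funext i
  rw [orderEmbOfFin_zero_union_omega h hB hB']
  cases i using Fin.cases with
  | zero => simp
  | succ i =>
    rw [Fin.rev_succ, Fin.snoc_castSucc, Fin.cons_succ, Fin.val_succ]
    push_cast
    ring

theorem yWeight_zero_union_omega {B : Finset ℤ} (h : ∀ b ∈ B, b ≤ 0) {p : ℕ}
    (hB : B.card = p) (hB' : ({0} ∪ omega B).card = p + 1) :
    (fun j : Fin (p + 1) =>
        (j : ℤ) + 1 - ((p + 1 : ℕ) : ℤ) - ({0} ∪ omega B).orderEmbOfFin hB' j) =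
      Fin.snoc (fun j : Fin p => (j : ℤ) + 1 - (p : ℤ) - B.orderEmbOfFin hB j) 0 := by
  funext j
  rw [orderEmbOfFin_zero_union_omega h hB hB']
  cases j using Fin.lastCases with
  | last => simp
  | cast j =>
    rw [Fin.snoc_castSucc, Fin.snoc_castSucc, Fin.val_castSucc]
    push_cast
    ring

/-! ### Kac modules, and the assembly of both formulas. -/

theorem schur_sub_one {F : Type*} [Field F] {k : ℕ} (lam : Fin k → ℤ) (x : Fin k → F)
    (hx : ∀ i, x i ≠ 0) : schur (fun i => lam i - 1) x = (∏ i, x i)⁻¹ * schur lam x := by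
  rw [schur, schur, ← mul_div_assoc, ← alternate_const_mul]
  congr 1
  refine alternate_congr fun σ => ?_
  rw [← prod_comp_perm x σ fun z => z, ← mul_assoc, ← Finset.prod_inv_distrib,
    ← Finset.prod_mul_distrib]
  congr 1
  exact Finset.prod_congr rfl fun i _ => by
    rw [zpow_sub_one₀ (show (x ∘ σ) i ≠ 0 from hx _), mul_comm]

theorem schur_add_one {F : Type*} [Field F] {k : ℕ} (lam : Fin k → ℤ) (x : Fin k → F)
    (hx : ∀ i, x i ≠ 0) : schur (fun i => lam i + 1) x = (∏ i, x i) * schur lam x := by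
  have h := schur_sub_one (fun i => lam i + 1) x hx
  simp only [add_sub_cancel_right] at h
  rw [h, ← mul_assoc, mul_inv_cancel₀ (Finset.prod_ne_zero_iff.2 fun i _ => hx i), one_mul]

theorem kacOfDiagram_self {F : Type*} [Field F] {n : ℕ} (A : Finset ℤ) (hA : A.card = n)
    (x y : Fin n → F) :
    kacOfDiagram A A hA hA x y =
      kacOfWeight (fun i : Fin n => A.orderEmbOfFin hA (Fin.rev i) + (i : ℤ))
        (fun j : Fin n => (j : ℤ) + 1 - (n : ℤ) - A.orderEmbOfFin hA j) x y := by
  subst hA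
  rfl

theorem kacOfDiagram_omega {F : Type*} [Field F] {n : ℕ} (A : Finset ℤ) (hA : A.card = n)
    (hA' : (omega A).card = n) (x y : Fin n → F) (hx : ∀ i, x i ≠ 0) (hy : ∀ i, y i ≠ 0) :
    (∏ j, y j) / (∏ i, x i) * kacOfDiagram A A hA hA x y =
      kacOfDiagram (omega A) (omega A) hA' hA' x y := by
  rw [kacOfDiagram_self, kacOfDiagram_self]
  simp only [orderEmbOfFin_omega hA hA', kacOfWeight]
  have h1 := schur_sub_one (fun i : Fin n => A.orderEmbOfFin hA (Fin.rev i) + (i : ℤ)) x hx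
  have h2 := schur_add_one (fun j : Fin n => (j : ℤ) + 1 - (n : ℤ) - A.orderEmbOfFin hA j) y hy
  simp only [sub_add_eq_add_sub, ← sub_add] at h1 h2 ⊢
  rw [h1, h2]
  ring

theorem eulerOfDiagram_omega {F : Type*} [Field F] [CharZero F] {n : ℕ} (B : Finset ℤ)
    (hB : ∀ b ∈ B, b ≤ 0) (x y : Fin n → F) (hx : ∀ i, x i ≠ 0) (hy : ∀ i, y i ≠ 0) :
    (∏ j, y j) / (∏ i, x i) * eulerOfDiagram B B x y =
      (-1) ^ (n + B.card) * (eulerOfDiagram (omega B) (omega B) x y -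
        (-1) ^ B.card * eulerOfDiagram ({0} ∪ omega B) ({0} ∪ omega B) x y) := by
  obtain ⟨p, hp⟩ : ∃ p, B.card = p := ⟨_, rfl⟩
  have hp1 : (omega B).card = p := (card_omega B).trans hp
  have hp2 : ({0} ∪ omega B).card = p + 1 := by rw [card_zero_union_omega hB, hp]
  have hshift : (fun i : Fin p => (omega B).orderEmbOfFin hp1 (Fin.rev i) + (i : ℤ)) =
      fun i : Fin p => (B.orderEmbOfFin hp (Fin.rev i) + (i : ℤ)) - 1 := by
    funext i
    rw [orderEmbOfFin_omega hp hp1]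
    ring
  have hshift' : (fun j : Fin p => (j : ℤ) + 1 - (p : ℤ) - (omega B).orderEmbOfFin hp1 j) =
      fun j : Fin p => ((j : ℤ) + 1 - (p : ℤ) - B.orderEmbOfFin hp j) + 1 := by
    funext j
    rw [orderEmbOfFin_omega hp hp1]
    ring
  rw [hp]
  rcases lt_trichotomy p n with hlt | rfl | hlt
  · obtain ⟨m, rfl⟩ : ∃ m, n = p + (m + 1) := ⟨n - p - 1, by omega⟩
    have h1 : p ≤ p + (m + 1) := by omega
    have h2 : p + 1 ≤ p + (m + 1) := by omega
    rw [eulerOfDiagram_self B hp h1, eulerOfDiagram_self (omega B) hp1 h1,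
      eulerOfDiagram_self ({0} ∪ omega B) hp2 h2, hshift, hshift',
      xWeight_zero_union_omega hB hp hp2, yWeight_zero_union_omega hB hp hp2]
    simp only [eulerOfWeight]
    rw [← mul_div_assoc, alternatePair_eulerTerm_recursion h1 h2 _ _ x y hx hy]
    ring
  -- For `p = n` the union has `n + 1` elements, so its Euler character is zero, and the sign
  -- `(-1)^(2p)` is `1`. What remains is the shift of weights, read off from the factorizations with
  -- an empty tail, `k = 0`.
  · rw [eulerOfDiagram_self_of_lt ({0} ∪ omega B) (by omega),
      eulerOfDiagram_self B hp le_rfl, eulerOfDiagram_self (omega B) hp1 le_rfl, hshift, hshift']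
    simp only [eulerOfWeight]
    rw [← two_mul, pow_mul, neg_one_sq, one_pow, one_mul, mul_zero, sub_zero, ← mul_div_assoc,
      ← alternatePair_const_mul]
    congr 1
    refine alternatePair_congr fun σ ρ => ?_
    rw [← prod_comp_perm x σ fun z => z, ← prod_comp_perm y ρ fun z => z]
    have h := eulerTerm_append_mul (k := 0) le_rfl
      (fun i : Fin p => B.orderEmbOfFin hp (Fin.rev i) + (i : ℤ))
      (fun j : Fin p => (j : ℤ) + 1 - (p : ℤ) - B.orderEmbOfFin hp j) (x ∘ σ) (y ∘ ρ) Fin.elim0 Fin.elim0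
      (fun i => hx _) fun i => hy _
    have h' := eulerTerm_omega_append (k := 0) le_rfl
      (fun i : Fin p => B.orderEmbOfFin hp (Fin.rev i) + (i : ℤ))
      (fun j : Fin p => (j : ℤ) + 1 - (p : ℤ) - B.orderEmbOfFin hp j) (x ∘ σ) (y ∘ ρ) Fin.elim0 Fin.elim0
    have ha : ∀ z : Fin p → F, Fin.append z (Fin.elim0 : Fin 0 → F) = z := fun z =>
      funext fun i => Fin.append_left z _ i
    simp only [Finset.univ_eq_empty, Finset.prod_empty, div_one, one_mul] at h
    rw [← h', ha, ha] at h
    exact h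
  · rw [eulerOfDiagram_self_of_lt B (by omega), eulerOfDiagram_self_of_lt (omega B) (by omega),
      eulerOfDiagram_self_of_lt ({0} ∪ omega B) (by omega)]
    ring

theorem varX_ne_zero (n : ℕ) (i : Fin n) : varX n i ≠ 0 :=
  (map_ne_zero_iff _ (IsFractionRing.injective _ _)).2 (MvPolynomial.X_ne_zero _)

theorem varY_ne_zero (n : ℕ) (j : Fin n) : varY n j ≠ 0 :=
  (map_ne_zero_iff _ (IsFractionRing.injective _ _)).2 (MvPolynomial.X_ne_zero _)

end GLSuper

theorem mainTheorem9 (n : ℕ) :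
    (∀ (A : Finset ℤ) (hA : A.card = n),
      GLSuper.T n (GLSuper.chK n A hA) =
        GLSuper.chK n (GLSuper.omega A) ((GLSuper.card_omega A).trans hA)) ∧
    (∀ B : Finset ℤ, (∀ b ∈ B, b ≤ 0) →
      GLSuper.T n (GLSuper.chE n B) =
        (-1) ^ (n + B.card) *
          (GLSuper.chE n (GLSuper.omega B) -
            (-1) ^ B.card * GLSuper.chE n ({0} ∪ GLSuper.omega B))) := by
  refine ⟨fun A hA => ?_, fun B hB => ?_⟩
  · exact GLSuper.kacOfDiagram_omega A hA _ _ _ (GLSuper.varX_ne_zero n) (GLSuper.varY_ne_zero n)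
  · exact GLSuper.eulerOfDiagram_omega B hB _ _ (GLSuper.varX_ne_zero n) (GLSuper.varY_ne_zero n)
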